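/- Let $\mathcal P_2(\mathbb R)$ be the set of Borel probability measures on $\mathbb R$ with finite second moment, with the $L^2$-Wasserstein distance $W_2$, $W_2(\mu,\nu)^2=\inf_\gamma\int|x-y|^2\,d\gamma(x,y)$, the infimum being over all couplings $\gamma$ of $\mu$ and $\nu$. For $V:\mathbb R\to[0,\infty)$ and $\mu\in\mathcal P_2(\mathbb R)$ let $$\Sigma_V(\mu)=-\iint_{\mathbb R^2}\log|x-y|\,d\mu(x)\,d\mu(y)+\int_{\mathbb R}V\,d\mu\in(-\infty,+\infty]$$ be the Voiculescu free entropy (with $-\log 0=+\infty$). **Theorem.** Let $V\in C^2(\mathbb R,[0,\infty))$ and let $K\in\mathbb R$ be such that $V''(x)\ge K$ for all $x\in\mathbb R$. Then $\mathrm{Hess}_{\mathcal P_2(\mathbb R)}\Sigma_V\ge K$, in the following two senses. (1) *$K$-displacement convexity.* For all $\mu_0,\mu_1\in\mathcal P_2(\mathbb R)$, every optimal coupling $\gamma$ of $\mu_0,\mu_1$ for the cost $|x-y|^2$, and every $s\in[0,1]$, the displacement interpolation $\mu_s=\big((x,y)\mapsto(1-s)x+sy\big)_\#\gamma$ satisfies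 $$\Sigma_V(\mu_s)+\frac K2\,s(1-s)\,W_2(\mu_0,\mu_1)^2\le(1-s)\,\Sigma_V(\mu_0)+s\,\Sigma_V(\mu_1)$$ (with the convention $0\cdot\infty=0$). (2) *Hessian.* Let $\mu\in\mathcal P_2(\mathbb R)$ with $\Sigma_V(\mu)<\infty$, let $v:\mathbb R\to\mathbb R$ be Lipschitz with compact support, and let $\mu_s=(\mathrm{id}+s\,v)_\#\mu$, which for small $|s|$ is the Wasserstein geodesic through $\mu$ with velocity $v$. Then $s\mapsto\Sigma_V(\mu_s)$ is finite and of class $C^2$ near $s=0$, and the Hessian $\mathrm{Hess}_{\mathcal P_2(\mathbb R)}\Sigma_V(\mu)(v,v):=\frac{d^2}{ds^2}\Sigma_V(\mu_s)\big|_{s=0}$ satisfies $$\mathrm{Hess}_{\mathcal P_2(\mathbb R)}\Sigma_V(\mu)(v,v)=\int_{\mathbb R}V''(x)\,|v(x)|^2\,d\mu(x)+\iint_{\mathbb R^2}\frac{|v(x)-v(y)|^2}{(x-y)^2}\,d\mu(x)\,d\mu(y)\ \ge\ K\int_{\mathbb R}|v(x)|^2\,d\mu(x),$$ both integrals on the left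 of the inequality being absolutely convergent. -/

import Mathlib

open MeasureTheory Filter Topology
open scoped ENNReal NNReal

noncomputable section

/-- Integral of an extended-real-valued function: the integral of the positive part minus the
integral of the negative part (meaningful when at most one of the two is infinite). -/
def extIntegral {α : Type*} [MeasurableSpace α] (μ : Measure α) (f : α → EReal) : EReal :=
  ((∫⁻ x, (f x).toENNReal ∂μ : ℝ≥0∞) : EReal) - ((∫⁻ x, (-f x).toENNReal ∂μ : ℝ≥0∞) : EReal)

/-- The free entropy `Σ_V(μ) = -∬ log|x-y| dμ(x) dμ(y) + ∫ V dμ`, with values in `(-∞, +∞]` for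
`μ` of finite second moment and `V ≥ 0`. Here `ENNReal.log 0 = -∞`, so that the logarithmic kernel
`-log|x-y|` is `+∞` on the diagonal. -/
def freeEntropy (V : ℝ → ℝ) (μ : Measure ℝ) : EReal :=
  extIntegral (μ.prod μ) (fun p => -ENNReal.log (edist p.1 p.2))
    + extIntegral μ (fun x => (V x : EReal))

/-- `μ ∈ P₂(ℝ)`: a Borel probability measure with finite second moment. -/
structure MemP2 (μ : Measure ℝ) : Prop where
  isProbabilityMeasure : IsProbabilityMeasure μ
  secondMoment : MemLp id 2 μ

/-- `γ` is a coupling (transport plan) of `μ` and `ν`. -/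
def IsCoupling (γ : Measure (ℝ × ℝ)) (μ ν : Measure ℝ) : Prop :=
  γ.map Prod.fst = μ ∧ γ.map Prod.snd = ν

/-- The quadratic transport cost `∫ |x - y|² dγ`. -/
def transportCost (γ : Measure (ℝ × ℝ)) : ℝ≥0∞ :=
  ∫⁻ p, edist p.1 p.2 ^ 2 ∂γ

/-- The `2`-Wasserstein distance (finite on `P₂(ℝ)`). -/
def wassersteinTwo (μ ν : Measure ℝ) : ℝ :=
  Real.sqrt (⨅ γ : {γ : Measure (ℝ × ℝ) // IsCoupling γ μ ν}, transportCost γ.1).toReal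

/-- `γ` is an optimal transport plan from `μ` to `ν` for the quadratic cost. -/
def IsOptimalPlan (γ : Measure (ℝ × ℝ)) (μ ν : Measure ℝ) : Prop :=
  IsCoupling γ μ ν ∧ ∀ γ' : Measure (ℝ × ℝ), IsCoupling γ' μ ν → transportCost γ ≤ transportCost γ'

/-- The displacement interpolation along a plan `γ`: the law of `(1 - s) x + s y` under `γ`. For an
optimal plan, `s ↦ displacement γ s` on `[0, 1]` is a constant speed Wasserstein geodesic, and in
`P₂(ℝ)` every constant speed geodesic is of this form. -/
def displacement (γ : Measure (ℝ × ℝ)) (s : ℝ) : Measure ℝ :=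
  γ.map (fun p => (1 - s) * p.1 + s * p.2)

/-- `F` is `K`-displacement convex, that is, `K`-convex along the geodesics of `P₂(ℝ)`. (In `EReal`,
`0 * ⊤ = 0`, so that the inequality is an equality at `s = 0` and `s = 1`.) -/
def DisplacementConvex (K : ℝ) (F : Measure ℝ → EReal) : Prop :=
  ∀ μ₀ μ₁ : Measure ℝ, MemP2 μ₀ → MemP2 μ₁ →
    ∀ γ : Measure (ℝ × ℝ), IsOptimalPlan γ μ₀ μ₁ → ∀ s : ℝ, 0 ≤ s → s ≤ 1 →
      F (displacement γ s) + ((K / 2 * (s * (1 - s)) * wassersteinTwo μ₀ μ₁ ^ 2 : ℝ) : EReal)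
        ≤ ((1 - s : ℝ) : EReal) * F μ₀ + (s : EReal) * F μ₁

/-- The geodesic through `μ` with initial velocity `v`: each particle moves at constant velocity,
`μ_s = (id + s v)_# μ`. For Lipschitz `v` and small `|s|` the map `id + s v` is increasing, so this
is a constant speed Wasserstein geodesic. -/
def geodesicFrom (μ : Measure ℝ) (v : ℝ → ℝ) (s : ℝ) : Measure ℝ :=
  μ.map (fun x => x + s * v x)

/-- The Wasserstein Hessian of `F` at `μ` in the direction `v` exists and equals `h`: along the
geodesic `μ_s` through `μ` with velocity `v`, `F` is finite and `C²` near `s = 0`, and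
`d²/ds² F(μ_s) = h` at `s = 0`. -/
structure HasWassersteinHessian (F : Measure ℝ → EReal) (μ : Measure ℝ) (v : ℝ → ℝ) (h : ℝ) :
    Prop where
  finite : ∀ᶠ s in 𝓝 (0 : ℝ), F (geodesicFrom μ v s) ≠ ⊤ ∧ F (geodesicFrom μ v s) ≠ ⊥
  contDiffAt : ContDiffAt ℝ 2 (fun s : ℝ => (F (geodesicFrom μ v s)).toReal) 0
  secondDeriv : iteratedDeriv 2 (fun s : ℝ => (F (geodesicFrom μ v s)).toReal) 0 = h

/-- Test velocities (Lipschitz with compact support) in the tangent space of `P₂(ℝ)`; on `ℝ` each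
of them is a gradient. -/
def IsTestVelocity (v : ℝ → ℝ) : Prop :=
  (∃ L : ℝ≥0, LipschitzWith L v) ∧ HasCompactSupport v

end

/-! On the line an optimal plan `γ` is monotone: for `γ ⊗ γ`-almost all pairs `(x, y)`, `(x', y')`,
the differences `x - x'` and `y - y'` never have opposite signs (`IsOptimalPlan.ae_monotone`). If
both entropies are finite these differences are almost surely nonzero, so interpolation keeps them
in one half-line, where `-log|·|` is convex (`combo_log_le`). The interaction is thus displacement
convex; the potential contributes `K`-convexity (`semiconvex_of_le_iteratedDeriv`). Integrating the
two pointwise inequalities against `γ ⊗ γ` and `γ` gives (1).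

For (2), with `q` the difference quotient of `v`, the difference of two moved points is `(x - y)(1 +
s q)` (`log_sub_geodesic_eq`). The singular part `log|x - y|` does not depend on `s`, and `q` is
bounded by the Lipschitz constant, so `log(1 + s q)` can be differentiated twice under the integral
for small `s`; minus its second derivative at `0` is `q²`. The potential contributes `V'' v²`, and
`q² ≥ 0`, `V'' ≥ K` give the lower bound. -/

/-! ### Finite free entropy in terms of real integrals -/

lemma extIntegral_eq_coe {α : Type*} [MeasurableSpace α] {μ : Measure α} {f : α → EReal}
    {g : α → ℝ} (hg : Integrable g μ) (hfg : ∀ᵐ x ∂μ, f x = (g x : EReal)) :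
    extIntegral μ f = ((∫ x, g x ∂μ : ℝ) : EReal) := by
  have h1 : ∫⁻ x, (f x).toENNReal ∂μ = ∫⁻ x, ENNReal.ofReal (g x) ∂μ := by
    refine lintegral_congr_ae ?_
    filter_upwards [hfg] with x hx
    rw [hx, EReal.toENNReal_of_ne_top (EReal.coe_ne_top _), EReal.toReal_coe]
  have h2 : ∫⁻ x, (-f x).toENNReal ∂μ = ∫⁻ x, ENNReal.ofReal (-g x) ∂μ := by
    refine lintegral_congr_ae ?_
    filter_upwards [hfg] with x hx
    rw [hx, ← EReal.coe_neg, EReal.toENNReal_of_ne_top (EReal.coe_ne_top _), EReal.toReal_coe]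
  have f1 : ∫⁻ x, ENNReal.ofReal (g x) ∂μ ≠ ⊤ := hg.lintegral_lt_top.ne
  have f2 : ∫⁻ x, ENNReal.ofReal (-g x) ∂μ ≠ ⊤ := hg.neg.lintegral_lt_top.ne
  rw [extIntegral, h1, h2, integral_eq_lintegral_pos_part_sub_lintegral_neg_part hg, EReal.coe_sub,
    EReal.coe_ennreal_toReal f1, EReal.coe_ennreal_toReal f2]

lemma extIntegral_ne_bot {α : Type*} [MeasurableSpace α] {μ : Measure α} {f : α → EReal}
    (hf : ∫⁻ x, (-f x).toENNReal ∂μ ≠ ⊤) : extIntegral μ f ≠ ⊥ := by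
  rw [extIntegral, sub_eq_add_neg, Ne, EReal.add_eq_bot_iff, not_or]
  refine ⟨EReal.coe_ennreal_ne_bot _, ?_⟩
  rw [EReal.neg_eq_bot_iff, EReal.coe_ennreal_eq_top_iff]
  exact hf

lemma integrable_of_extIntegral_ne_top {α : Type*} [MeasurableSpace α] {μ : Measure α}
    {f : α → EReal} (hm : Measurable f) (hf : ∫⁻ x, (-f x).toENNReal ∂μ ≠ ⊤)
    (h : extIntegral μ f ≠ ⊤) :
    (∀ᵐ x ∂μ, f x ≠ ⊤) ∧ Integrable (fun x => (f x).toReal) μ := by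
  have hf' : ∫⁻ x, (f x).toENNReal ∂μ ≠ ⊤ := by
    intro htop
    apply h
    rw [extIntegral, htop, EReal.coe_ennreal_top, sub_eq_add_neg]
    apply EReal.top_add_of_ne_bot
    rw [Ne, EReal.neg_eq_bot_iff, EReal.coe_ennreal_eq_top_iff]
    exact hf
  have m1 : Measurable fun x => (f x).toENNReal := hm.ereal_toENNReal
  have m2 : Measurable fun x => (-f x).toENNReal := hm.neg.ereal_toENNReal
  have a1 : ∀ᵐ x ∂μ, f x ≠ ⊤ := by
    filter_upwards [ae_lt_top m1 hf'] with x hx hx'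
    simp [hx'] at hx
  refine ⟨a1, ?_⟩
  have i1 := integrable_toReal_of_lintegral_ne_top m1.aemeasurable hf'
  have i2 := integrable_toReal_of_lintegral_ne_top m2.aemeasurable hf
  refine (i1.sub i2).congr ?_
  filter_upwards [a1, ae_lt_top m2 hf] with x hx hx'
  have hbot : f x ≠ ⊥ := by
    intro hb
    simp [hb] at hx'
  have := EReal.coe_toReal hx hbot
  simp only [Pi.sub_apply]
  rw [← this, ← EReal.coe_neg, EReal.toENNReal_of_ne_top (EReal.coe_ne_top _),
    EReal.toENNReal_of_ne_top (EReal.coe_ne_top _)]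
  simp only [EReal.toReal_coe]
  rw [ENNReal.toReal_ofReal', ENNReal.toReal_ofReal']
  rcases le_total 0 (f x).toReal with h0 | h0
  · rw [max_eq_left h0, max_eq_right (by linarith), sub_zero]
  · rw [max_eq_right h0, max_eq_left (by linarith)]; ring

/-- `Real.log` is even, so `Real.log (x - y)` serves as `log|x - y|` from here on. -/
lemma neg_log_edist_of_ne {x y : ℝ} (h : x ≠ y) :
    -ENNReal.log (edist x y) = ((-Real.log (x - y) : ℝ) : EReal) := by
  have : 0 < |x - y| := abs_pos.mpr (sub_ne_zero.mpr h)
  rw [edist_dist, Real.dist_eq, ENNReal.log_ofReal_of_pos this, Real.log_abs, EReal.coe_neg]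

lemma log_le_abs (x : ℝ) : Real.log x ≤ |x| := by
  rw [← Real.log_abs]
  exact Real.log_le_self (abs_nonneg x)

lemma MemP2.integrable_id {μ : Measure ℝ} (h : MemP2 μ) : Integrable (fun x : ℝ => x) μ := by
  have := h.isProbabilityMeasure
  exact h.secondMoment.integrable (by norm_num)

lemma MemP2.integrable_abs_add_abs {μ : Measure ℝ} (h : MemP2 μ) :
    Integrable (fun p : ℝ × ℝ => |p.1| + |p.2|) (μ.prod μ) := by
  have := h.isProbabilityMeasure
  exact (h.integrable_id.abs.comp_fst μ).add (h.integrable_id.abs.comp_snd μ)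

/-- The negative part of the kernel is at most `|x| + |y|`, since `log t ≤ t`; it vanishes on the
diagonal, where the kernel is `+∞`. Hence the interaction energy is never `-∞`. -/
lemma MemP2.lintegral_neg_kernel_ne_top {μ : Measure ℝ} (h : MemP2 μ) :
    ∫⁻ p : ℝ × ℝ, (-(-ENNReal.log (edist p.1 p.2))).toENNReal ∂(μ.prod μ) ≠ ⊤ := by
  refine ne_top_of_le_ne_top h.integrable_abs_add_abs.lintegral_lt_top.ne (lintegral_mono fun p => ?_)
  rcases eq_or_ne p.1 p.2 with hp | hp
  · simp [hp]
  · rw [neg_log_edist_of_ne hp, ← EReal.coe_neg, EReal.toENNReal_of_ne_top (EReal.coe_ne_top _),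
      EReal.toReal_coe, neg_neg]
    exact ENNReal.ofReal_le_ofReal ((log_le_abs _).trans (abs_sub _ _))

lemma lintegral_neg_coe_eq_zero {V : ℝ → ℝ} (hV0 : ∀ x, 0 ≤ V x) (μ : Measure ℝ) :
    ∫⁻ x, (-(V x : EReal)).toENNReal ∂μ = 0 := by
  have : ∀ x, (-(V x : EReal)).toENNReal = 0 := fun x => by
    rw [← EReal.coe_neg, EReal.toENNReal_of_ne_top (EReal.coe_ne_top _), EReal.toReal_coe]
    exact ENNReal.ofReal_of_nonpos (by linarith [hV0 x])
  rw [lintegral_congr this, lintegral_zero]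

lemma freeEntropy_ne_bot {V : ℝ → ℝ} (hV0 : ∀ x, 0 ≤ V x) {μ : Measure ℝ} (h : MemP2 μ) :
    freeEntropy V μ ≠ ⊥ := by
  rw [freeEntropy, Ne, EReal.add_eq_bot_iff, not_or]
  refine ⟨extIntegral_ne_bot h.lintegral_neg_kernel_ne_top, extIntegral_ne_bot ?_⟩
  rw [lintegral_neg_coe_eq_zero hV0]
  exact ENNReal.zero_ne_top

/-- The real form of "`μ` has finite free entropy": the diagonal is `μ ⊗ μ`-null and both the
logarithmic kernel and the potential are integrable. -/
structure HasFiniteFreeEntropy (V : ℝ → ℝ) (μ : Measure ℝ) : Prop where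
  ae_ne : ∀ᵐ p : ℝ × ℝ ∂(μ.prod μ), p.1 ≠ p.2
  integrable_log : Integrable (fun p : ℝ × ℝ => Real.log (p.1 - p.2)) (μ.prod μ)
  integrable_potential : Integrable V μ

/-- The null diagonal is essential: there `Real.log 0 = 0`, whereas the true kernel is `+∞`. -/
lemma HasFiniteFreeEntropy.freeEntropy_eq {V : ℝ → ℝ} {μ : Measure ℝ}
    (h : HasFiniteFreeEntropy V μ) :
    freeEntropy V μ =
      ((-∫ p : ℝ × ℝ, Real.log (p.1 - p.2) ∂(μ.prod μ)) + ∫ x, V x ∂μ : ℝ) := by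
  rw [freeEntropy, extIntegral_eq_coe h.integrable_log.neg, extIntegral_eq_coe h.integrable_potential
    (ae_of_all _ fun _ => rfl), EReal.coe_add]
  · simp only [Pi.neg_apply, integral_neg]
  · filter_upwards [h.ae_ne] with p hp
    rw [neg_log_edist_of_ne hp, Pi.neg_apply]

/-- Neither summand is `⊥`, so a sum below `⊤` makes each finite; a kernel that is finite almost
everywhere forces the diagonal to be null. -/
lemma hasFiniteFreeEntropy_of_ne_top {V : ℝ → ℝ} (hV : Continuous V) (hV0 : ∀ x, 0 ≤ V x)
    {μ : Measure ℝ} (hμ : MemP2 μ) (h : freeEntropy V μ ≠ ⊤) : HasFiniteFreeEntropy V μ := by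
  have n1 := hμ.lintegral_neg_kernel_ne_top
  have n2 : ∫⁻ x, (-(V x : EReal)).toENNReal ∂μ ≠ ⊤ := by
    rw [lintegral_neg_coe_eq_zero hV0]; exact ENNReal.zero_ne_top
  rw [freeEntropy, EReal.add_ne_top_iff_ne_top₂ (extIntegral_ne_bot n1) (extIntegral_ne_bot n2)] at h
  have m1 : Measurable fun p : ℝ × ℝ => -ENNReal.log (edist p.1 p.2) :=
    (ENNReal.measurable_log.comp (measurable_fst.edist measurable_snd)).neg
  obtain ⟨a1, i1⟩ := integrable_of_extIntegral_ne_top m1 n1 h.1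
  obtain ⟨-, i2⟩ := integrable_of_extIntegral_ne_top hV.measurable.coe_real_ereal n2 h.2
  have ane : ∀ᵐ p : ℝ × ℝ ∂(μ.prod μ), p.1 ≠ p.2 := by
    filter_upwards [a1] with p hp hpe
    simp [hpe] at hp
  refine ⟨ane, i1.neg.congr ?_, by simpa using i2⟩
  filter_upwards [ane] with p hp
  rw [Pi.neg_apply, neg_log_edist_of_ne hp, EReal.toReal_coe, neg_neg]

/-! ### Couplings and monotonicity of optimal plans -/

lemma IsCoupling.isProbabilityMeasure {γ : Measure (ℝ × ℝ)} {μ ν : Measure ℝ}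
    (h : IsCoupling γ μ ν) (hμ : MemP2 μ) : IsProbabilityMeasure γ := by
  have := hμ.isProbabilityMeasure
  refine ⟨?_⟩
  have h1 : γ.map Prod.fst Set.univ = 1 := by rw [h.1]; exact measure_univ
  rwa [Measure.map_apply measurable_fst MeasurableSet.univ, Set.preimage_univ] at h1

lemma IsCoupling.memLp_fst {γ : Measure (ℝ × ℝ)} {μ ν : Measure ℝ}
    (h : IsCoupling γ μ ν) (hμ : MemP2 μ) : MemLp (fun p : ℝ × ℝ => p.1) 2 γ := by
  have h2 := hμ.secondMoment
  rw [← h.1, memLp_map_measure_iff aestronglyMeasurable_id measurable_fst.aemeasurable] at h2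
  exact h2

lemma IsCoupling.memLp_snd {γ : Measure (ℝ × ℝ)} {μ ν : Measure ℝ}
    (h : IsCoupling γ μ ν) (hν : MemP2 ν) : MemLp (fun p : ℝ × ℝ => p.2) 2 γ := by
  have h2 := hν.secondMoment
  rw [← h.2, memLp_map_measure_iff aestronglyMeasurable_id measurable_snd.aemeasurable] at h2
  exact h2

lemma transportCost_eq_lintegral_ofReal (γ : Measure (ℝ × ℝ)) :
    transportCost γ = ∫⁻ p, ENNReal.ofReal ((p.1 - p.2) ^ 2) ∂γ := by
  refine lintegral_congr fun p => ?_
  rw [edist_dist, Real.dist_eq, ← ENNReal.ofReal_pow (abs_nonneg _), sq_abs]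

lemma IsCoupling.integrable_sq_sub {γ : Measure (ℝ × ℝ)} {μ ν : Measure ℝ}
    (h : IsCoupling γ μ ν) (hμ : MemP2 μ) (hν : MemP2 ν) :
    Integrable (fun p : ℝ × ℝ => (p.1 - p.2) ^ 2) γ :=
  ((h.memLp_fst hμ).sub (h.memLp_snd hν)).integrable_sq

lemma IsCoupling.transportCost_eq {γ : Measure (ℝ × ℝ)} {μ ν : Measure ℝ}
    (h : IsCoupling γ μ ν) (hμ : MemP2 μ) (hν : MemP2 ν) :
    transportCost γ = ENNReal.ofReal (∫ p, (p.1 - p.2) ^ 2 ∂γ) := by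
  rw [transportCost_eq_lintegral_ofReal, ofReal_integral_eq_lintegral_ofReal
    (h.integrable_sq_sub hμ hν) (ae_of_all _ fun p => sq_nonneg _)]

lemma IsOptimalPlan.wassersteinTwo_sq {γ : Measure (ℝ × ℝ)} {μ ν : Measure ℝ}
    (h : IsOptimalPlan γ μ ν) (hμ : MemP2 μ) (hν : MemP2 ν) :
    wassersteinTwo μ ν ^ 2 = ∫ p, (p.1 - p.2) ^ 2 ∂γ := by
  have h1 : (⨅ γ' : {γ : Measure (ℝ × ℝ) // IsCoupling γ μ ν}, transportCost γ'.1)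
      = transportCost γ :=
    le_antisymm (iInf_le (fun γ' : {γ : Measure (ℝ × ℝ) // IsCoupling γ μ ν} =>
      transportCost γ'.1) ⟨γ, h.1⟩) (le_iInf fun γ' => h.2 _ γ'.2)
  rw [wassersteinTwo, h1, Real.sq_sqrt ENNReal.toReal_nonneg, h.1.transportCost_eq hμ hν,
    ENNReal.toReal_ofReal (integral_nonneg fun p => sq_nonneg _)]

/-- The pairs of transported points whose order is reversed. -/
def crossingSet : Set ((ℝ × ℝ) × (ℝ × ℝ)) :=
  {q | (q.1.1 - q.2.1) * (q.1.2 - q.2.2) < 0}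

lemma measurableSet_crossingSet : MeasurableSet crossingSet :=
  measurableSet_lt (by fun_prop) measurable_const

lemma swap_mem_crossingSet (q : (ℝ × ℝ) × (ℝ × ℝ)) : q.swap ∈ crossingSet ↔ q ∈ crossingSet := by
  simp only [crossingSet, Set.mem_ofPred_eq, Prod.fst_swap, Prod.snd_swap]
  rw [show (q.2.1 - q.1.1) * (q.2.2 - q.1.2) = (q.1.1 - q.2.1) * (q.1.2 - q.2.2) by ring]

open Classical in
/-- Exchange the targets of two crossing transported points. -/
noncomputable def uncross (q : (ℝ × ℝ) × (ℝ × ℝ)) : ℝ × ℝ :=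
  (q.1.1, if q ∈ crossingSet then q.2.2 else q.1.2)

lemma measurable_uncross : Measurable uncross :=
  Measurable.prodMk (by fun_prop) (Measurable.ite measurableSet_crossingSet (by fun_prop) (by fun_prop))

lemma lintegral_comp_swap {α : Type*} [MeasurableSpace α] (γ : Measure α) [SFinite γ]
    {f : α × α → ℝ≥0∞} (hf : Measurable f) :
    ∫⁻ q, f q.swap ∂(γ.prod γ) = ∫⁻ q, f q ∂(γ.prod γ) := by
  conv_rhs => rw [← Measure.prod_swap]
  rw [lintegral_map hf measurable_swap]

/-- Sources are untouched. Targets are exchanged on a set symmetric under swapping the two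
independent samples, and `γ ⊗ γ` is invariant under that swap, so the law of the target is
unchanged. -/
lemma isCoupling_map_uncross (γ : Measure (ℝ × ℝ)) [IsProbabilityMeasure γ] :
    IsCoupling ((γ.prod γ).map uncross) (γ.map Prod.fst) (γ.map Prod.snd) := by
  classical
  refine ⟨?_, ?_⟩
  · rw [Measure.map_map measurable_fst measurable_uncross]
    have : Prod.fst ∘ uncross = Prod.fst ∘ (Prod.fst : (ℝ × ℝ) × (ℝ × ℝ) → ℝ × ℝ) := rfl
    rw [this, ← Measure.map_map measurable_fst measurable_fst, Measure.map_fst_prod]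
    simp
  · have e : γ.map Prod.snd = (γ.prod γ).map (fun q => q.1.2) := by
      have : (fun q : (ℝ × ℝ) × (ℝ × ℝ) => q.1.2) = Prod.snd ∘ Prod.fst := rfl
      rw [this, ← Measure.map_map measurable_snd measurable_fst, Measure.map_fst_prod]
      simp
    rw [e, Measure.map_map measurable_snd measurable_uncross]
    refine Measure.ext_of_lintegral _ fun f hf => ?_
    have m1 : Measurable fun q : (ℝ × ℝ) × (ℝ × ℝ) => f q.1.2 := hf.comp (by fun_prop)
    rw [lintegral_map hf (measurable_snd.comp measurable_uncross), lintegral_map hf (by fun_prop)]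
    have hA := measurableSet_crossingSet
    -- On the crossing set, the new target of `q` is the old target of `q.swap`.
    have s1 : ∀ q, f ((Prod.snd ∘ uncross) q) =
        crossingSet.indicator (fun q => f q.1.2) q.swap + crossingSetᶜ.indicator (fun q => f q.1.2) q := by
      intro q
      by_cases hq : q ∈ crossingSet
      · simp [uncross, hq, (swap_mem_crossingSet q).2 hq]
      · simp [uncross, hq, mt (swap_mem_crossingSet q).1 hq]
    have s2 : ∀ q, f q.1.2 =
        crossingSet.indicator (fun q => f q.1.2) q + crossingSetᶜ.indicator (fun q => f q.1.2) q := by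
      intro q
      by_cases hq : q ∈ crossingSet <;> simp [hq]
    rw [lintegral_congr s1, lintegral_congr s2, lintegral_add_right _ (m1.indicator hA.compl),
      lintegral_add_right _ (m1.indicator hA.compl), lintegral_comp_swap γ (m1.indicator hA)]

/-- An optimal plan for the quadratic cost on the line is monotone. -/
lemma IsOptimalPlan.ae_monotone {γ : Measure (ℝ × ℝ)} {μ ν : Measure ℝ}
    (h : IsOptimalPlan γ μ ν) (hμ : MemP2 μ) (hν : MemP2 ν) :
    ∀ᵐ q : (ℝ × ℝ) × (ℝ × ℝ) ∂(γ.prod γ), 0 ≤ (q.1.1 - q.2.1) * (q.1.2 - q.2.2) := by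
  classical
  have := h.1.isProbabilityMeasure hμ
  have hc : IsCoupling ((γ.prod γ).map uncross) μ ν := by
    have := isCoupling_map_uncross γ
    rwa [h.1.1, h.1.2] at this
  have hsq : Measurable fun p : ℝ × ℝ => (p.1 - p.2) ^ 2 := by fun_prop
  have hle := h.2 _ hc
  rw [h.1.transportCost_eq hμ hν, hc.transportCost_eq hμ hν, ENNReal.ofReal_le_ofReal_iff
    (integral_nonneg fun p => sq_nonneg _), integral_map measurable_uncross.aemeasurable
    hsq.aestronglyMeasurable] at hle
  have i0 := h.1.integrable_sq_sub hμ hν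
  have i1 : Integrable (fun q : (ℝ × ℝ) × (ℝ × ℝ) => (q.1.1 - q.1.2) ^ 2) (γ.prod γ) :=
    i0.comp_fst γ
  have i2 : Integrable (fun q => ((uncross q).1 - (uncross q).2) ^ 2) (γ.prod γ) :=
    (integrable_map_measure hsq.aestronglyMeasurable measurable_uncross.aemeasurable).1
      (hc.integrable_sq_sub hμ hν)
  have e1 : ∫ p, (p.1 - p.2) ^ 2 ∂γ = ∫ q : (ℝ × ℝ) × (ℝ × ℝ), (q.1.1 - q.1.2) ^ 2 ∂(γ.prod γ) := by
    rw [integral_fun_fst (fun p : ℝ × ℝ => (p.1 - p.2) ^ 2)]; simp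
  rw [e1] at hle
  -- `F` is the cost saved by uncrossing. Optimality gives `∫ F ≤ 0`, while its symmetrization is
  -- nonnegative, and positive exactly on crossings; these must therefore be null.
  set F : (ℝ × ℝ) × (ℝ × ℝ) → ℝ := fun q => (q.1.1 - q.1.2) ^ 2 - ((uncross q).1 - (uncross q).2) ^ 2
    with hF
  have iF : Integrable F (γ.prod γ) := i1.sub i2
  have hF0 : ∫ q, F q ∂(γ.prod γ) ≤ 0 := by
    rw [hF, integral_sub i1 i2]; linarith
  have iFs : Integrable (fun q => F q.swap) (γ.prod γ) := iF.swap
  have key : ∀ q, F q + F q.swap =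
      if q ∈ crossingSet then -2 * ((q.1.1 - q.2.1) * (q.1.2 - q.2.2)) else 0 := by
    intro q
    by_cases hq : q ∈ crossingSet
    · simp only [hF, uncross, hq, (swap_mem_crossingSet q).2 hq, if_true, Prod.fst_swap,
        Prod.snd_swap]
      ring
    · simp only [hF, uncross, hq, mt (swap_mem_crossingSet q).1 hq, if_false, Prod.fst_swap,
        Prod.snd_swap]
      ring
  have hnn : ∀ q, 0 ≤ F q + F q.swap := by
    intro q
    rw [key]
    split_ifs with hq
    · have : (q.1.1 - q.2.1) * (q.1.2 - q.2.2) < 0 := hq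
      linarith
    · exact le_rfl
  have hz : ∫ q, (F q + F q.swap) ∂(γ.prod γ) = 0 := by
    refine le_antisymm ?_ (integral_nonneg hnn)
    rw [integral_add iF iFs, integral_prod_swap F]
    linarith
  have := (integral_eq_zero_iff_of_nonneg_ae (ae_of_all _ hnn) (iF.add iFs)).1 hz
  filter_upwards [this] with q hq
  by_contra! hlt
  have hq' : F q + F q.swap = 0 := hq
  rw [key, if_pos (show q ∈ crossingSet from hlt)] at hq'
  linarith

/-! ### Free entropy of a push-forward -/

section PushForward

variable {α : Type*} [MeasurableSpace α] {γ : Measure α} [SFinite γ] {f : α → ℝ} {V : ℝ → ℝ}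

lemma map_prod_map_self (γ : Measure α) [SFinite γ] (hf : Measurable f) :
    (γ.map f).prod (γ.map f) = (γ.prod γ).map (Prod.map f f) :=
  Measure.map_prod_map γ γ hf hf

/-- Pulling back to one fixed measure turns entropies along a geodesic into integrals of different
functions against that measure, comparable pointwise. -/
lemma hasFiniteFreeEntropy_map_iff (hf : Measurable f) (hV : Continuous V) :
    HasFiniteFreeEntropy V (γ.map f) ↔
      (∀ᵐ q : α × α ∂(γ.prod γ), f q.1 ≠ f q.2) ∧
      Integrable (fun q : α × α => Real.log (f q.1 - f q.2)) (γ.prod γ) ∧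
      Integrable (fun a => V (f a)) γ := by
  have hff : AEMeasurable (Prod.map f f) (γ.prod γ) := (hf.prodMap hf).aemeasurable
  have hs : MeasurableSet {p : ℝ × ℝ | p.1 ≠ p.2} :=
    (measurableSet_eq_fun measurable_fst measurable_snd).compl
  have hl : AEStronglyMeasurable (fun p : ℝ × ℝ => Real.log (p.1 - p.2))
      ((γ.prod γ).map (Prod.map f f)) :=
    (Real.measurable_log.comp (measurable_fst.sub measurable_snd)).aestronglyMeasurable
  constructor
  · rintro ⟨h1, h2, h3⟩
    rw [map_prod_map_self γ hf] at h1 h2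
    exact ⟨(ae_map_iff hff hs).1 h1, (integrable_map_measure hl hff).1 h2,
      (integrable_map_measure hV.aestronglyMeasurable hf.aemeasurable).1 h3⟩
  · rintro ⟨h1, h2, h3⟩
    refine ⟨?_, ?_, (integrable_map_measure hV.aestronglyMeasurable hf.aemeasurable).2 h3⟩
    · rw [map_prod_map_self γ hf]; exact (ae_map_iff hff hs).2 h1
    · rw [map_prod_map_self γ hf]; exact (integrable_map_measure hl hff).2 h2

lemma HasFiniteFreeEntropy.freeEntropy_map_eq (hf : Measurable f) (hV : Continuous V)
    (h : HasFiniteFreeEntropy V (γ.map f)) :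
    freeEntropy V (γ.map f) =
      ((-∫ q : α × α, Real.log (f q.1 - f q.2) ∂(γ.prod γ)) + ∫ a, V (f a) ∂γ : ℝ) := by
  have hl : Measurable fun p : ℝ × ℝ => Real.log (p.1 - p.2) :=
    Real.measurable_log.comp (measurable_fst.sub measurable_snd)
  rw [h.freeEntropy_eq, map_prod_map_self γ hf, integral_map (hf.prodMap hf).aemeasurable
    hl.aestronglyMeasurable, integral_map hf.aemeasurable hV.aestronglyMeasurable]
  rfl

end PushForward

/-! ### Displacement convexity -/

lemma convexOn_sub_sq {V : ℝ → ℝ} {K : ℝ} (hV : ContDiff ℝ 2 V)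
    (hK : ∀ x, K ≤ iteratedDeriv 2 V x) :
    ConvexOn ℝ Set.univ fun x => V x - K / 2 * x ^ 2 := by
  have hV1 : Differentiable ℝ V := hV.differentiable (by norm_num)
  have hV2 : Differentiable ℝ (deriv V) := by
    have := hV.differentiable_iteratedDeriv 1 (by norm_num)
    rwa [iteratedDeriv_one] at this
  have d1 : deriv (fun x => V x - K / 2 * x ^ 2) = fun x => deriv V x - K * x := by
    funext x
    have := (hV1 x).hasDerivAt.sub (((hasDerivAt_id x).pow 2).const_mul (K / 2))
    refine (this.congr_deriv ?_).deriv
    simp only [id]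
    ring
  refine convexOn_univ_of_deriv2_nonneg (by fun_prop) (by rw [d1]; fun_prop) fun x => ?_
  have d2 : deriv (fun x => deriv V x - K * x) x = deriv (deriv V) x - K := by
    have := (hV2 x).hasDerivAt.sub ((hasDerivAt_id x).const_mul K)
    refine (this.congr_deriv ?_).deriv
    ring
  have hKx := hK x
  rw [iteratedDeriv_succ, iteratedDeriv_one] at hKx
  simp only [Function.iterate_succ, Function.iterate_zero, Function.comp_apply, id]
  rw [d1, d2]
  linarith

/-- Convexity of `V - K x²/2`, combined with `(1-s)x² + s y² - ((1-s)x + s y)² = s(1-s)(x-y)²`. -/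
lemma semiconvex_of_le_iteratedDeriv {V : ℝ → ℝ} {K : ℝ} (hV : ContDiff ℝ 2 V)
    (hK : ∀ x, K ≤ iteratedDeriv 2 V x) {s : ℝ} (h0 : 0 ≤ s) (h1 : s ≤ 1) (x y : ℝ) :
    V ((1 - s) * x + s * y) + K / 2 * (s * (1 - s)) * (x - y) ^ 2 ≤ (1 - s) * V x + s * V y := by
  have := (convexOn_sub_sq hV hK).2 (Set.mem_univ x) (Set.mem_univ y) (sub_nonneg.2 h1) h0
    (by ring)
  simp only [smul_eq_mul] at this
  linear_combination this

/-- Nonzero numbers with nonnegative product share a sign. Concavity of `log` settles the positive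
case, and evenness of `Real.log` reduces the negative case to it. -/
lemma combo_log_le {s x y : ℝ} (h0 : 0 ≤ s) (h1 : s ≤ 1) (hx : x ≠ 0) (hy : y ≠ 0)
    (hxy : 0 ≤ x * y) :
    (1 - s) * x + s * y ≠ 0 ∧
      (1 - s) * Real.log x + s * Real.log y ≤ Real.log ((1 - s) * x + s * y) := by
  have pos : ∀ a b : ℝ, 0 < a → 0 < b → 0 < (1 - s) * a + s * b ∧
      (1 - s) * Real.log a + s * Real.log b ≤ Real.log ((1 - s) * a + s * b) := by
    intro a b ha hb
    refine ⟨(convex_Ioi (0 : ℝ)) ha hb (sub_nonneg.2 h1) h0 (by ring), ?_⟩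
    simpa using strictConcaveOn_log_Ioi.concaveOn.2 ha hb (sub_nonneg.2 h1) h0 (by ring)
  rcases lt_or_gt_of_ne hx with hx' | hx'
  · have hy' : y < 0 := by
      rcases lt_or_gt_of_ne hy with h | h
      · exact h
      · nlinarith
    obtain ⟨p1, p2⟩ := pos (-x) (-y) (by linarith) (by linarith)
    have e : (1 - s) * -x + s * -y = -((1 - s) * x + s * y) := by ring
    rw [e] at p1 p2
    rw [Real.log_neg_eq_log, Real.log_neg_eq_log, Real.log_neg_eq_log] at p2
    exact ⟨(neg_pos.1 p1).ne, p2⟩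
  · have hy' : 0 < y := by
      rcases lt_or_gt_of_ne hy with h | h
      · nlinarith
      · exact h
    exact ⟨(pos x y hx' hy').1.ne', (pos x y hx' hy').2⟩

lemma freeEntropy_displacement_le {V : ℝ → ℝ} {K : ℝ} (hV : ContDiff ℝ 2 V)
    (hV0 : ∀ x, 0 ≤ V x) (hK : ∀ x, K ≤ iteratedDeriv 2 V x) {μ ν : Measure ℝ} (hμ : MemP2 μ)
    (hν : MemP2 ν) {γ : Measure (ℝ × ℝ)} (hγ : IsOptimalPlan γ μ ν) {s : ℝ} (h0 : 0 ≤ s)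
    (h1 : s ≤ 1) (eμ : HasFiniteFreeEntropy V μ) (eν : HasFiniteFreeEntropy V ν) :
    freeEntropy V (displacement γ s)
        + ((K / 2 * (s * (1 - s)) * wassersteinTwo μ ν ^ 2 : ℝ) : EReal)
      ≤ ((1 - s : ℝ) : EReal) * freeEntropy V μ + (s : EReal) * freeEntropy V ν := by
  have := hγ.1.isProbabilityMeasure hμ
  have hVc := hV.continuous
  have eμ' := eμ
  have eν' := eν
  rw [← hγ.1.1] at eμ'
  rw [← hγ.1.2] at eν'
  have fμ := eμ'.freeEntropy_map_eq measurable_fst hVc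
  have fν := eν'.freeEntropy_map_eq measurable_snd hVc
  rw [hγ.1.1] at fμ
  rw [hγ.1.2] at fν
  obtain ⟨nμ, lμ, vμ⟩ := (hasFiniteFreeEntropy_map_iff measurable_fst hVc).1 eμ'
  obtain ⟨nν, lν, vν⟩ := (hasFiniteFreeEntropy_map_iff measurable_snd hVc).1 eν'
  have hT : Measurable fun p : ℝ × ℝ => (1 - s) * p.1 + s * p.2 := by fun_prop
  have hsq := hγ.1.integrable_sq_sub hμ hν
  have ix : Integrable (fun p : ℝ × ℝ => p.1) γ := (hγ.1.memLp_fst hμ).integrable (by norm_num)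
  have iy : Integrable (fun p : ℝ × ℝ => p.2) γ := (hγ.1.memLp_snd hν).integrable (by norm_num)
  have iT := (ix.const_mul (1 - s)).add (iy.const_mul s)
  have iTT : Integrable (fun q : (ℝ × ℝ) × (ℝ × ℝ) => |(1 - s) * q.1.1 + s * q.1.2|
      + |(1 - s) * q.2.1 + s * q.2.2|) (γ.prod γ) :=
    (iT.abs.comp_fst γ).add (iT.abs.comp_snd γ)
  have ilow := (lμ.const_mul (1 - s)).add (lν.const_mul s)
  have hae : ∀ᵐ q : (ℝ × ℝ) × (ℝ × ℝ) ∂(γ.prod γ),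
      (1 - s) * q.1.1 + s * q.1.2 ≠ (1 - s) * q.2.1 + s * q.2.2 ∧
      (1 - s) * Real.log (q.1.1 - q.2.1) + s * Real.log (q.1.2 - q.2.2) ≤
        Real.log (((1 - s) * q.1.1 + s * q.1.2) - ((1 - s) * q.2.1 + s * q.2.2)) := by
    filter_upwards [nμ, nν, hγ.ae_monotone hμ hν] with q q1 q2 q3
    obtain ⟨c1, c2⟩ := combo_log_le h0 h1 (sub_ne_zero.2 q1) (sub_ne_zero.2 q2) q3
    have e : (1 - s) * (q.1.1 - q.2.1) + s * (q.1.2 - q.2.2) =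
      ((1 - s) * q.1.1 + s * q.1.2) - ((1 - s) * q.2.1 + s * q.2.2) := by ring
    rw [e] at c1 c2
    exact ⟨sub_ne_zero.1 c1, c2⟩
  -- The interpolated logarithm lies between the integrable concavity bound and the linear growth
  -- bound `log|a - b| ≤ |a| + |b|`.
  have ilog : Integrable (fun q : (ℝ × ℝ) × (ℝ × ℝ) =>
      Real.log (((1 - s) * q.1.1 + s * q.1.2) - ((1 - s) * q.2.1 + s * q.2.2))) (γ.prod γ) := by
    refine (ilow.abs.add iTT).mono' (Measurable.aestronglyMeasurable (by fun_prop)) ?_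
    filter_upwards [hae] with q hq
    rw [Real.norm_eq_abs, abs_le]
    simp only [Pi.add_apply]
    have u := (log_le_abs (((1 - s) * q.1.1 + s * q.1.2) - ((1 - s) * q.2.1 + s * q.2.2))).trans
      (abs_sub _ _)
    have l := neg_abs_le ((1 - s) * Real.log (q.1.1 - q.2.1) + s * Real.log (q.1.2 - q.2.2))
    have l' := abs_nonneg ((1 - s) * Real.log (q.1.1 - q.2.1) + s * Real.log (q.1.2 - q.2.2))
    have l'' := abs_nonneg ((1 - s) * q.1.1 + s * q.1.2)
    have l3 := abs_nonneg ((1 - s) * q.2.1 + s * q.2.2)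
    constructor <;> linarith [hq.2]
  have ivv : Integrable (fun p : ℝ × ℝ => (1 - s) * V p.1 + s * V p.2) γ :=
    (vμ.const_mul (1 - s)).add (vν.const_mul s)
  have iup := ivv.sub
    (hsq.const_mul (K / 2 * (s * (1 - s))))
  have hVle : ∀ p : ℝ × ℝ, V ((1 - s) * p.1 + s * p.2) ≤
      (1 - s) * V p.1 + s * V p.2 - K / 2 * (s * (1 - s)) * (p.1 - p.2) ^ 2 := fun p => by
    linarith [semiconvex_of_le_iteratedDeriv hV hK h0 h1 p.1 p.2]
  have iV : Integrable (fun p : ℝ × ℝ => V ((1 - s) * p.1 + s * p.2)) γ := by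
    refine iup.mono' (hVc.measurable.comp hT).aestronglyMeasurable (ae_of_all _ fun p => ?_)
    rw [Real.norm_of_nonneg (hV0 _)]
    exact hVle p
  have es : HasFiniteFreeEntropy V (displacement γ s) :=
    (hasFiniteFreeEntropy_map_iff hT hVc).2 ⟨hae.mono fun q hq => hq.1, ilog, iV⟩
  have fs : freeEntropy V (displacement γ s) = _ := es.freeEntropy_map_eq hT hVc
  rw [fs, fμ, fν, hγ.wassersteinTwo_sq hμ hν, ← EReal.coe_mul, ← EReal.coe_mul, ← EReal.coe_add,
    ← EReal.coe_add, EReal.coe_le_coe_iff]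
  have I1 := integral_mono_ae ilow ilog (hae.mono fun q hq => hq.2)
  have I2 := integral_mono iV iup hVle
  simp only [Pi.add_apply, Pi.sub_apply] at I1 I2
  rw [integral_add (lμ.const_mul (1 - s)) (lν.const_mul s), integral_const_mul,
    integral_const_mul] at I1
  rw [integral_sub ivv (hsq.const_mul _),
    integral_add (vμ.const_mul (1 - s)) (vν.const_mul s), integral_const_mul, integral_const_mul,
    integral_const_mul] at I2
  linarith

lemma displacementConvex_freeEntropy {V : ℝ → ℝ} {K : ℝ} (hV : ContDiff ℝ 2 V)
    (hV0 : ∀ x, 0 ≤ V x) (hK : ∀ x, K ≤ iteratedDeriv 2 V x) :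
    DisplacementConvex K (freeEntropy V) := by
  intro μ ν hμ hν γ hγ s h0 h1
  have bμ := freeEntropy_ne_bot hV0 hμ
  have bν := freeEntropy_ne_bot hV0 hν
  have nonbot : ∀ {r : ℝ} {x : EReal}, 0 ≤ r → x ≠ ⊥ → (r : EReal) * x ≠ ⊥ := by
    intro r x hr hx
    rcases hr.eq_or_lt with rfl | hr
    · simp
    · induction x with
      | bot => exact absurd rfl hx
      | top => rw [EReal.coe_mul_top_of_pos hr]; simp
      | coe x => rw [← EReal.coe_mul]; exact EReal.coe_ne_bot _
  -- The endpoints are separate because `0 * ⊤ = 0`. For `0 < s < 1`, an infinite endpoint entropy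
  -- makes the right side `⊤`, provided that the other term is not `⊥`.
  rcases h0.eq_or_lt with rfl | h0'
  · have : displacement γ 0 = μ := by
      rw [← hγ.1.1, displacement]; congr 1; funext p; ring
    rw [this]; simp
  rcases h1.eq_or_lt with rfl | h1'
  · have : displacement γ 1 = ν := by
      rw [← hγ.1.2, displacement]; congr 1; funext p; ring
    rw [this]; simp
  by_cases tμ : freeEntropy V μ = ⊤
  · rw [tμ, EReal.coe_mul_top_of_pos (sub_pos.2 h1'), EReal.top_add_of_ne_bot (nonbot h0 bν)]
    exact le_top
  by_cases tν : freeEntropy V ν = ⊤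
  · rw [tν, EReal.coe_mul_top_of_pos h0', EReal.add_top_of_ne_bot (nonbot (sub_nonneg.2 h1) bμ)]
    exact le_top
  exact freeEntropy_displacement_le hV hV0 hK hμ hν hγ h0 h1
    (hasFiniteFreeEntropy_of_ne_top hV.continuous hV0 hμ tμ)
    (hasFiniteFreeEntropy_of_ne_top hV.continuous hV0 hν tν)

/-! ### Second-order differentiation under the integral sign -/

lemma contDiffAt_two_of_hasDerivAt {F F' F'' : ℝ → ℝ} {δ : ℝ} (hδ : 0 < δ)
    (h1 : ∀ s ∈ Metric.ball (0 : ℝ) δ, HasDerivAt F (F' s) s)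
    (h2 : ∀ s ∈ Metric.ball (0 : ℝ) δ, HasDerivAt F' (F'' s) s)
    (h3 : ∀ s ∈ Metric.ball (0 : ℝ) δ, ContinuousAt F'' s) :
    ContDiffAt ℝ 2 F 0 ∧ iteratedDeriv 2 F 0 = F'' 0 := by
  have ho : IsOpen (Metric.ball (0 : ℝ) δ) := Metric.isOpen_ball
  have h0 : (0 : ℝ) ∈ Metric.ball (0 : ℝ) δ := Metric.mem_ball_self hδ
  have c0 : ContDiffOn ℝ 0 F'' (Metric.ball 0 δ) :=
    contDiffOn_zero.2 fun s hs => (h3 s hs).continuousWithinAt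
  have c1 : ContDiffOn ℝ (0 + 1) F' (Metric.ball 0 δ) :=
    (contDiffOn_succ_iff_deriv_of_isOpen ho).2
      ⟨fun s hs => (h2 s hs).differentiableAt.differentiableWithinAt, by simp,
        c0.congr fun s hs => (h2 s hs).deriv⟩
  have c2 : ContDiffOn ℝ (0 + 1 + 1) F (Metric.ball 0 δ) :=
    (contDiffOn_succ_iff_deriv_of_isOpen ho).2
      ⟨fun s hs => (h1 s hs).differentiableAt.differentiableWithinAt, by simp,
        c1.congr fun s hs => (h1 s hs).deriv⟩
  refine ⟨?_, ?_⟩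
  · have := c2.contDiffAt (ho.mem_nhds h0)
    norm_num at this
    exact this
  · rw [iteratedDeriv_succ, iteratedDeriv_one]
    have : deriv F =ᶠ[𝓝 0] F' := by
      filter_upwards [ho.mem_nhds h0] with s hs using (h1 s hs).deriv
    rw [this.deriv_eq, (h2 0 h0).deriv]

section ParametricIntegral

variable {α : Type*} [MeasurableSpace α] {μ : Measure α} [IsFiniteMeasure μ]

lemma hasDerivAt_integral_of_bounded {φ φ' : ℝ → α → ℝ} {δ C : ℝ}
    (h0 : ∀ s ∈ Metric.ball (0 : ℝ) δ, Integrable (φ s) μ)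
    (m1 : ∀ s, AEStronglyMeasurable (φ' s) μ)
    (b1 : ∀ s ∈ Metric.ball (0 : ℝ) δ, ∀ a, |φ' s a| ≤ C)
    (d1 : ∀ s ∈ Metric.ball (0 : ℝ) δ, ∀ a, HasDerivAt (fun s => φ s a) (φ' s a) s) :
    ∀ s ∈ Metric.ball (0 : ℝ) δ, HasDerivAt (fun s => ∫ a, φ s a ∂μ) (∫ a, φ' s a ∂μ) s := by
  intro s hs
  have hn := Metric.isOpen_ball.mem_nhds hs
  refine (hasDerivAt_integral_of_dominated_loc_of_deriv_le (bound := fun _ => C) hn ?_ (h0 s hs)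
    (m1 s) (ae_of_all _ fun a t ht => b1 t ht a) (integrable_const C)
    (ae_of_all _ fun a t ht => d1 t ht a)).2
  filter_upwards [hn] with t ht using (h0 t ht).aestronglyMeasurable

lemma continuousAt_integral_of_bounded {φ : ℝ → α → ℝ} {δ C : ℝ}
    (m : ∀ s, AEStronglyMeasurable (φ s) μ)
    (b : ∀ s ∈ Metric.ball (0 : ℝ) δ, ∀ a, |φ s a| ≤ C)
    (c : ∀ s ∈ Metric.ball (0 : ℝ) δ, ∀ a, ContinuousAt (fun s => φ s a) s) :
    ∀ s ∈ Metric.ball (0 : ℝ) δ, ContinuousAt (fun s => ∫ a, φ s a ∂μ) s := by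
  intro s hs
  have hn := Metric.isOpen_ball.mem_nhds hs
  refine continuousAt_of_dominated (bound := fun _ => C) (Eventually.of_forall m) ?_
    (integrable_const C) (ae_of_all _ fun a => c s hs a)
  filter_upwards [hn] with t ht using ae_of_all _ fun a => b t ht a

lemma integrable_of_abs_le {f : α → ℝ} {C : ℝ} (m : AEStronglyMeasurable f μ)
    (b : ∀ a, |f a| ≤ C) : Integrable f μ :=
  (integrable_const C).mono' m (ae_of_all _ b)

end ParametricIntegral

/-- The difference quotient of `v`. -/
noncomputable def differenceQuotient (v : ℝ → ℝ) (p : ℝ × ℝ) : ℝ := (v p.1 - v p.2) / (p.1 - p.2)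

lemma LipschitzWith.abs_differenceQuotient_le {v : ℝ → ℝ} {L : ℝ≥0} (hv : LipschitzWith L v)
    (p : ℝ × ℝ) : |differenceQuotient v p| ≤ L := by
  rw [differenceQuotient, abs_div]
  -- This form of the division bound also covers the diagonal, where the quotient is `0 / 0 = 0`.
  refine div_le_of_le_mul₀ (abs_nonneg _) L.2 ?_
  simpa [Real.dist_eq] using hv.dist_le_mul p.1 p.2

lemma measurable_differenceQuotient {v : ℝ → ℝ} (hv : Measurable v) :
    Measurable (differenceQuotient v) := by
  unfold differenceQuotient
  fun_prop

/-- The radius makes `|s q| < 1/2`; using `L + 1` instead of `L` allows `L = 0` and keeps the radius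
below `1`. -/
lemma half_le_one_add_mul {q s L : ℝ} (hL : 0 ≤ L) (hq : |q| ≤ L)
    (hs : s ∈ Metric.ball (0 : ℝ) (1 / (2 * (L + 1)))) : 1 / 2 ≤ 1 + s * q := by
  rw [mem_ball_zero_iff, Real.norm_eq_abs, lt_div_iff₀ (by positivity)] at hs
  have h1 : |s * q| ≤ |s| * (L + 1) := by
    rw [abs_mul]
    exact mul_le_mul_of_nonneg_left (by linarith) (abs_nonneg s)
  have := neg_abs_le (s * q)
  linarith

/-- Only `x` in the compact support of `w` matters, and a continuous function is bounded on the
compact set of relevant `(s, x)`. This supplies the dominating constants for the derivatives of the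
potential part. -/
lemma exists_abs_comp_mul_le {g v w : ℝ → ℝ} (hg : Continuous g) (hv : Continuous v)
    (hw : Continuous w) (hc : HasCompactSupport w) :
    ∃ C, ∀ s ∈ Metric.ball (0 : ℝ) 1, ∀ x, |g (x + s * v x) * w x| ≤ C := by
  have hk : IsCompact (Metric.closedBall (0 : ℝ) 1 ×ˢ tsupport w) :=
    (isCompact_closedBall 0 1).prod hc
  have hcont : Continuous fun p : ℝ × ℝ => g (p.2 + p.1 * v p.2) * w p.2 := by fun_prop
  obtain ⟨C, hC⟩ := hk.exists_bound_of_continuousOn hcont.continuousOn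
  refine ⟨max C 0, fun s hs x => ?_⟩
  by_cases hx : x ∈ tsupport w
  · exact (hC (s, x) ⟨Metric.ball_subset_closedBall hs, hx⟩).trans (le_max_left _ _)
  · rw [image_eq_zero_of_notMem_tsupport hx]
    simp

lemma hasDerivAt_log_one_add_mul {q s : ℝ} (h : 0 < 1 + s * q) :
    HasDerivAt (fun s => Real.log (1 + s * q)) (q / (1 + s * q)) s := by
  have : HasDerivAt (fun s => 1 + s * q) q s := by
    simpa using ((hasDerivAt_id s).mul_const q).const_add 1
  exact this.log h.ne'

lemma hasDerivAt_div_one_add_mul {q s : ℝ} (h : 0 < 1 + s * q) :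
    HasDerivAt (fun s => q / (1 + s * q)) (-(q ^ 2 / (1 + s * q) ^ 2)) s := by
  have : HasDerivAt (fun s => 1 + s * q) q s := by
    simpa using ((hasDerivAt_id s).mul_const q).const_add 1
  refine ((hasDerivAt_const s q).div this h.ne').congr_deriv ?_
  ring

/-- Points outside the support of `v` do not move, so compactness controls the rest. Hence
integrability of `V` passes to the moved measure without any growth condition on `V`. -/
lemma exists_comp_le_add {V v : ℝ → ℝ} (hV : Continuous V) (hV0 : ∀ x, 0 ≤ V x)
    (hv : Continuous v) (hc : HasCompactSupport v) :
    ∃ C, ∀ s ∈ Metric.ball (0 : ℝ) 1, ∀ x, V (x + s * v x) ≤ V x + C := by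
  have hk : IsCompact (Metric.closedBall (0 : ℝ) 1 ×ˢ tsupport v) :=
    (isCompact_closedBall 0 1).prod hc
  have hcont : Continuous fun p : ℝ × ℝ => V (p.2 + p.1 * v p.2) := by fun_prop
  obtain ⟨C, hC⟩ := hk.exists_bound_of_continuousOn hcont.continuousOn
  refine ⟨max C 0, fun s hs x => ?_⟩
  by_cases hx : x ∈ tsupport v
  · have h1 := (le_abs_self _).trans (hC (s, x) ⟨Metric.ball_subset_closedBall hs, hx⟩)
    have h2 := le_max_left C 0
    have h3 := hV0 x
    dsimp only at h1
    linarith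
  · rw [image_eq_zero_of_notMem_tsupport hx]
    simp

lemma ball_subset_unit_ball {L : ℝ} (hL : 0 ≤ L) :
    Metric.ball (0 : ℝ) (1 / (2 * (L + 1))) ⊆ Metric.ball 0 1 := by
  refine Metric.ball_subset_ball ?_
  rw [div_le_one (by positivity)]
  linarith

lemma abs_div_one_add_mul_le {q L : ℝ} (hL : 0 ≤ L) (hq : |q| ≤ L) {s : ℝ}
    (hs : s ∈ Metric.ball (0 : ℝ) (1 / (2 * (L + 1)))) : |q / (1 + s * q)| ≤ 2 * L := by
  have h1 := half_le_one_add_mul hL hq hs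
  rw [abs_div, abs_of_pos (show 0 < 1 + s * q by linarith)]
  refine div_le_of_le_mul₀ (by linarith) (by linarith) ?_
  nlinarith [hq]

section LogPart

variable {α : Type*} [MeasurableSpace α] {π : Measure α} [IsFiniteMeasure π] {q : α → ℝ} {L : ℝ}

lemma integrable_log_one_add_mul (hL : 0 ≤ L) (hm : Measurable q) (hq : ∀ a, |q a| ≤ L) {s : ℝ}
    (hs : s ∈ Metric.ball (0 : ℝ) (1 / (2 * (L + 1)))) :
    Integrable (fun a => Real.log (1 + s * q a)) π := by
  -- From `1 - 1/t ≤ log t ≤ t - 1` at `t = 1 + s q ≥ 1/2`, the logarithm lies between `-1` and `|s|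
  -- L`.
  refine integrable_of_abs_le (C := |s| * L + 2) (Measurable.aestronglyMeasurable (by fun_prop))
    fun a => ?_
  have h1 := half_le_one_add_mul hL (hq a) hs
  have h2 : |s * q a| ≤ |s| * L := by
    rw [abs_mul]; exact mul_le_mul_of_nonneg_left (hq a) (abs_nonneg s)
  have h3 := le_abs_self (s * q a)
  have h4 := Real.log_le_sub_one_of_pos (show 0 < 1 + s * q a by linarith)
  have h5 := Real.one_sub_inv_le_log_of_pos (show 0 < 1 + s * q a by linarith)
  have h6 : (1 + s * q a)⁻¹ ≤ 2 := by
    rw [inv_le_comm₀ (by linarith) (by norm_num)]; linarith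
  have h7 := (abs_nonneg _).trans h2
  rw [abs_le]
  constructor <;> linarith

lemma integral_log_one_add_mul_calculus (hL : 0 ≤ L) (hm : Measurable q) (hq : ∀ a, |q a| ≤ L) :
    ∀ s ∈ Metric.ball (0 : ℝ) (1 / (2 * (L + 1))),
      HasDerivAt (fun s => ∫ a, Real.log (1 + s * q a) ∂π) (∫ a, q a / (1 + s * q a) ∂π) s ∧
      HasDerivAt (fun s => ∫ a, q a / (1 + s * q a) ∂π)
        (∫ a, -(q a ^ 2 / (1 + s * q a) ^ 2) ∂π) s ∧
      ContinuousAt (fun s => ∫ a, -(q a ^ 2 / (1 + s * q a) ^ 2) ∂π) s := by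
  have pos : ∀ s ∈ Metric.ball (0 : ℝ) (1 / (2 * (L + 1))), ∀ a, 0 < 1 + s * q a :=
    fun s hs a => by linarith [half_le_one_add_mul hL (hq a) hs]
  have m1 : ∀ s, AEStronglyMeasurable (fun a => q a / (1 + s * q a)) π :=
    fun s => Measurable.aestronglyMeasurable (by fun_prop)
  have m2 : ∀ s, AEStronglyMeasurable (fun a => -(q a ^ 2 / (1 + s * q a) ^ 2)) π :=
    fun s => Measurable.aestronglyMeasurable (by fun_prop)
  have b1 : ∀ s ∈ Metric.ball (0 : ℝ) (1 / (2 * (L + 1))), ∀ a,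
      |q a / (1 + s * q a)| ≤ 2 * L := fun s hs a => abs_div_one_add_mul_le hL (hq a) hs
  have b2 : ∀ s ∈ Metric.ball (0 : ℝ) (1 / (2 * (L + 1))), ∀ a,
      |-(q a ^ 2 / (1 + s * q a) ^ 2)| ≤ (2 * L) ^ 2 := fun s hs a => by
    rw [abs_neg, ← div_pow, abs_pow]
    exact pow_le_pow_left₀ (abs_nonneg _) (b1 s hs a) 2
  intro s hs
  refine ⟨hasDerivAt_integral_of_bounded (fun s hs => integrable_log_one_add_mul hL hm hq hs) m1 b1
      (fun s hs a => hasDerivAt_log_one_add_mul (pos s hs a)) s hs,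
    hasDerivAt_integral_of_bounded (fun s hs => integrable_of_abs_le (m1 s) (b1 s hs)) m2 b2
      (fun s hs a => hasDerivAt_div_one_add_mul (pos s hs a)) s hs,
    continuousAt_integral_of_bounded m2 b2 (fun s hs a => ?_) s hs⟩
  have := (pos s hs a).ne'
  exact ContinuousAt.neg (ContinuousAt.div (by fun_prop) (by fun_prop) (pow_ne_zero 2 this))

end LogPart

lemma integrable_comp_add_mul {V v : ℝ → ℝ} (hV : Continuous V) (hV0 : ∀ x, 0 ≤ V x)
    (hv : Continuous v) (hc : HasCompactSupport v) {μ : Measure ℝ} [IsFiniteMeasure μ]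
    (hi : Integrable V μ) {s : ℝ} (hs : s ∈ Metric.ball (0 : ℝ) 1) :
    Integrable (fun x => V (x + s * v x)) μ := by
  obtain ⟨C, hC⟩ := exists_comp_le_add hV hV0 hv hc
  refine (hi.add (integrable_const C)).mono' (Continuous.aestronglyMeasurable (by fun_prop))
    (ae_of_all _ fun x => ?_)
  rw [Real.norm_of_nonneg (hV0 _)]
  exact hC s hs x

lemma integral_comp_add_mul_calculus {V v : ℝ → ℝ} (hV : ContDiff ℝ 2 V) (hV0 : ∀ x, 0 ≤ V x)
    (hv : Continuous v) (hc : HasCompactSupport v) {μ : Measure ℝ} [IsFiniteMeasure μ]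
    (hi : Integrable V μ) :
    ∀ s ∈ Metric.ball (0 : ℝ) 1,
      HasDerivAt (fun s => ∫ x, V (x + s * v x) ∂μ) (∫ x, deriv V (x + s * v x) * v x ∂μ) s ∧
      HasDerivAt (fun s => ∫ x, deriv V (x + s * v x) * v x ∂μ)
        (∫ x, iteratedDeriv 2 V (x + s * v x) * v x ^ 2 ∂μ) s ∧
      ContinuousAt (fun s => ∫ x, iteratedDeriv 2 V (x + s * v x) * v x ^ 2 ∂μ) s := by
  have hV1 : Differentiable ℝ V := hV.differentiable (by norm_num)
  have hV2 : Differentiable ℝ (deriv V) := by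
    have := hV.differentiable_iteratedDeriv 1 (by norm_num)
    rwa [iteratedDeriv_one] at this
  have hV3 : Continuous (iteratedDeriv 2 V) := hV.continuous_iteratedDeriv 2 le_rfl
  have hd : ∀ y, HasDerivAt (deriv V) (iteratedDeriv 2 V y) y := fun y => by
    rw [iteratedDeriv_succ, iteratedDeriv_one]
    exact (hV2 y).hasDerivAt
  have hc1 := hV2.continuous
  have hc2 : HasCompactSupport fun x => v x ^ 2 :=
    hc.comp_left (g := fun y : ℝ => y ^ 2) (by norm_num)
  obtain ⟨C1, b1⟩ := exists_abs_comp_mul_le hc1 hv hv hc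
  obtain ⟨C2, b2⟩ := exists_abs_comp_mul_le hV3 hv (hv.pow 2) hc2
  have m1 : ∀ s, AEStronglyMeasurable (fun x => deriv V (x + s * v x) * v x) μ :=
    fun s => Continuous.aestronglyMeasurable (by fun_prop)
  have m2 : ∀ s, AEStronglyMeasurable (fun x => iteratedDeriv 2 V (x + s * v x) * v x ^ 2) μ :=
    fun s => Continuous.aestronglyMeasurable (by fun_prop)
  have hin : ∀ s x, HasDerivAt (fun s => x + s * v x) (v x) s := fun s x => by
    simpa using ((hasDerivAt_id s).mul_const (v x)).const_add x
  intro s hs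
  refine ⟨hasDerivAt_integral_of_bounded
      (fun s hs => integrable_comp_add_mul hV.continuous hV0 hv hc hi hs) m1 b1
      (fun s _ x => ((hV1 _).hasDerivAt.comp s (hin s x))) s hs,
    hasDerivAt_integral_of_bounded (fun s hs => integrable_of_abs_le (m1 s) (b1 s hs)) m2 b2
      (fun s _ x => ?_) s hs,
    continuousAt_integral_of_bounded m2 b2
      (fun s _ x => Continuous.continuousAt (by fun_prop)) s hs⟩
  refine (((hd _).comp s (hin s x)).mul_const (v x)).congr_deriv ?_
  ring

/-! ### The Wasserstein Hessian -/

/-- Factoring out `x - y` isolates the singularity in a term independent of `s`; the other factor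
stays at least `1/2`, so distinct points remain distinct. -/
lemma log_sub_geodesic_eq {v : ℝ → ℝ} {L : ℝ≥0} (hL : LipschitzWith L v) {s : ℝ}
    (hs : s ∈ Metric.ball (0 : ℝ) (1 / (2 * ((L : ℝ) + 1)))) {p : ℝ × ℝ} (hp : p.1 ≠ p.2) :
    p.1 + s * v p.1 ≠ p.2 + s * v p.2 ∧
    Real.log ((p.1 + s * v p.1) - (p.2 + s * v p.2)) =
      Real.log (p.1 - p.2) + Real.log (1 + s * differenceQuotient v p) := by
  have h1 := half_le_one_add_mul L.2 (hL.abs_differenceQuotient_le p) hs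
  have hp' := sub_ne_zero.2 hp
  have h1' : 1 + s * differenceQuotient v p ≠ 0 :=
    (lt_of_lt_of_le (by norm_num) h1).ne'
  have e : (p.1 + s * v p.1) - (p.2 + s * v p.2) =
      (p.1 - p.2) * (1 + s * differenceQuotient v p) := by
    rw [differenceQuotient]
    field_simp
    ring
  refine ⟨?_, ?_⟩
  · rw [← sub_ne_zero, e]
    exact mul_ne_zero hp' h1'
  · rw [e, Real.log_mul hp' h1']

lemma hasWassersteinHessian_freeEntropy {V : ℝ → ℝ} (hV : ContDiff ℝ 2 V)
    (hV0 : ∀ x, 0 ≤ V x) {μ : Measure ℝ} (hμ : MemP2 μ) (hfin : freeEntropy V μ ≠ ⊤) {v : ℝ → ℝ}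
    (hv : IsTestVelocity v) :
    HasWassersteinHessian (freeEntropy V) μ v ((∫ x, iteratedDeriv 2 V x * v x ^ 2 ∂μ)
      + ∫ p : ℝ × ℝ, (v p.1 - v p.2) ^ 2 / (p.1 - p.2) ^ 2 ∂(μ.prod μ)) := by
  have := hμ.isProbabilityMeasure
  obtain ⟨⟨L, hL⟩, hc⟩ := hv
  have hvc := hL.continuous
  have hmq := measurable_differenceQuotient hvc.measurable
  have hbq := hL.abs_differenceQuotient_le
  have eμ := hasFiniteFreeEntropy_of_ne_top hV.continuous hV0 hμ hfin
  have hL0 : (0 : ℝ) ≤ L := L.2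
  have hδ : 0 < 1 / (2 * ((L : ℝ) + 1)) := by positivity
  have hsub := ball_subset_unit_ball hL0
  have hT : ∀ s, Measurable fun x => x + s * v x := fun s => by
    have := hvc.measurable
    fun_prop
  have es : ∀ s ∈ Metric.ball (0 : ℝ) (1 / (2 * ((L : ℝ) + 1))),
      HasFiniteFreeEntropy V (geodesicFrom μ v s) := fun s hs =>
    (hasFiniteFreeEntropy_map_iff (hT s) hV.continuous).2
      ⟨eμ.ae_ne.mono fun p hp => (log_sub_geodesic_eq hL hs hp).1,
        (eμ.integrable_log.add (integrable_log_one_add_mul hL0 hmq hbq hs)).congr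
          (eμ.ae_ne.mono fun p hp => (log_sub_geodesic_eq hL hs hp).2.symm),
        integrable_comp_add_mul hV.continuous hV0 hvc hc eμ.integrable_potential (hsub hs)⟩
  have hval : ∀ s ∈ Metric.ball (0 : ℝ) (1 / (2 * ((L : ℝ) + 1))),
      freeEntropy V (geodesicFrom μ v s) =
        ((-∫ p : ℝ × ℝ, Real.log (p.1 - p.2) ∂(μ.prod μ))
          - (∫ p, Real.log (1 + s * differenceQuotient v p) ∂(μ.prod μ))
          + ∫ x, V (x + s * v x) ∂μ : ℝ) := fun s hs => by
    rw [show freeEntropy V (geodesicFrom μ v s) = _ from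
      (es s hs).freeEntropy_map_eq (hT s) hV.continuous, integral_congr_ae
      (eμ.ae_ne.mono fun p hp => (log_sub_geodesic_eq hL hs hp).2), integral_add
      eμ.integrable_log (integrable_log_one_add_mul hL0 hmq hbq hs), neg_add, sub_eq_add_neg]
  have hlog := integral_log_one_add_mul_calculus (π := μ.prod μ) hL0 hmq hbq
  have hpot := integral_comp_add_mul_calculus hV hV0 hvc hc eμ.integrable_potential
  have hball := Metric.isOpen_ball.mem_nhds (Metric.mem_ball_self (x := (0 : ℝ)) hδ)
  have hev : (fun s : ℝ => (freeEntropy V (geodesicFrom μ v s)).toReal) =ᶠ[𝓝 0] fun s =>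
      (-∫ p : ℝ × ℝ, Real.log (p.1 - p.2) ∂(μ.prod μ))
          - (∫ p, Real.log (1 + s * differenceQuotient v p) ∂(μ.prod μ))
          + ∫ x, V (x + s * v x) ∂μ := by
    filter_upwards [hball] with s hs
    rw [hval s hs, EReal.toReal_coe]
  obtain ⟨c1, c2⟩ := contDiffAt_two_of_hasDerivAt hδ
    (fun s hs => ((hlog s hs).1.const_sub
      (-∫ p : ℝ × ℝ, Real.log (p.1 - p.2) ∂(μ.prod μ))).add (hpot s (hsub hs)).1)
    (fun s hs => (hlog s hs).2.1.neg.add (hpot s (hsub hs)).2.1)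
    (fun s hs => (hlog s hs).2.2.neg.add (hpot s (hsub hs)).2.2)
  refine ⟨?_, c1.congr_of_eventuallyEq hev, ?_⟩
  · filter_upwards [hball] with s hs
    rw [hval s hs]
    exact ⟨EReal.coe_ne_top _, EReal.coe_ne_bot _⟩
  · rw [hev.iteratedDeriv_eq]
    refine c2.trans ?_
    simp only [zero_mul, add_zero, one_pow, div_one, integral_neg,
      neg_neg, differenceQuotient, div_pow]
    exact add_comm _ _

theorem theorem3p5 (V : ℝ → ℝ) (K : ℝ) (hV : ContDiff ℝ 2 V) (hV0 : ∀ x : ℝ, 0 ≤ V x)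
    (hK : ∀ x : ℝ, K ≤ iteratedDeriv 2 V x) :
    DisplacementConvex K (freeEntropy V) ∧
    ∀ μ : Measure ℝ, MemP2 μ → freeEntropy V μ ≠ ⊤ → ∀ v : ℝ → ℝ, IsTestVelocity v →
      ∃ h : ℝ, HasWassersteinHessian (freeEntropy V) μ v h ∧
        Integrable (fun x : ℝ => iteratedDeriv 2 V x * v x ^ 2) μ ∧
        Integrable (fun p : ℝ × ℝ => (v p.1 - v p.2) ^ 2 / (p.1 - p.2) ^ 2) (μ.prod μ) ∧
        h = (∫ x, iteratedDeriv 2 V x * v x ^ 2 ∂μ)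
          + ∫ p : ℝ × ℝ, (v p.1 - v p.2) ^ 2 / (p.1 - p.2) ^ 2 ∂(μ.prod μ) ∧
        K * ∫ x, v x ^ 2 ∂μ ≤ h := by
  refine ⟨displacementConvex_freeEntropy hV hV0 hK, fun μ hμ hfin v hv => ?_⟩
  have := hμ.isProbabilityMeasure
  have hHess := hasWassersteinHessian_freeEntropy hV hV0 hμ hfin hv
  obtain ⟨⟨L, hL⟩, hc⟩ := hv
  have hvc := hL.continuous
  have hc2 : HasCompactSupport fun x => v x ^ 2 :=
    hc.comp_left (g := fun y : ℝ => y ^ 2) (by norm_num)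
  have hV3 : Continuous (iteratedDeriv 2 V) := hV.continuous_iteratedDeriv 2 le_rfl
  have i0 : Integrable (fun x => v x ^ 2) μ := (hvc.pow 2).integrable_of_hasCompactSupport hc2
  -- `V''` may be unbounded above; the compact support of `v` gives integrability.
  have i1 : Integrable (fun x => iteratedDeriv 2 V x * v x ^ 2) μ :=
    (hV3.mul (hvc.pow 2)).integrable_of_hasCompactSupport hc2.mul_left
  have i2 : Integrable (fun p : ℝ × ℝ => (v p.1 - v p.2) ^ 2 / (p.1 - p.2) ^ 2) (μ.prod μ) := by
    have := integrable_of_abs_le (μ := μ.prod μ) (C := (L : ℝ) ^ 2)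
      ((measurable_differenceQuotient hvc.measurable).pow_const 2).aestronglyMeasurable fun p => by
        rw [abs_pow]
        exact pow_le_pow_left₀ (abs_nonneg _) (hL.abs_differenceQuotient_le p) 2
    simpa only [differenceQuotient, div_pow] using this
  refine ⟨_, hHess, i1, i2, rfl, ?_⟩
  have h1 : K * ∫ x, v x ^ 2 ∂μ ≤ ∫ x, iteratedDeriv 2 V x * v x ^ 2 ∂μ := by
    rw [← integral_const_mul]
    exact integral_mono (i0.const_mul K) i1 fun x =>
      mul_le_mul_of_nonneg_right (hK x) (sq_nonneg _)
  have h2 : 0 ≤ ∫ p : ℝ × ℝ, (v p.1 - v p.2) ^ 2 / (p.1 - p.2) ^ 2 ∂(μ.prod μ) :=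
    integral_nonneg fun p => by positivity
  linarith
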